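/- **Conventions.** For a real number $\lambda$, a real sequence $(b_s)_{s\ge 1}$ and $r\in\mathbb N$, let $\nu^{(r)}_{\lambda,b}$ be the signed measure on $\mathbb N$ with Fourier transform $$\sum_{k\ge 0}\nu^{(r)}_{\lambda,b}(k)\,e^{ik\xi}=e^{\lambda(e^{i\xi}-1)}\Bigl(1+\sum_{s=1}^r b_s\,(e^{i\xi}-1)^s\Bigr).$$ For a probability measure $\mu$ and a signed measure $\nu$ on $\mathbb N$, let $d_{\mathrm{TV}}(\mu,\nu)=\frac12\sum_{k\ge0}|\mu(k)-\nu(k)|$. For a real family $A=(a_i)_{i\in\mathbb N}$ with $\sum_i a_i^2<\infty$ (finite families are completed by zeros), let $\mathfrak E(A',z)=\prod_{i}(1+a_iz)e^{-a_iz}$, and let $(\mathfrak e_s(A'))_{s\ge0}$ be the elementary symmetric functions for the specialisation of symmetric functions whose power sums are $\mathfrak p_1(A')=0$ and $\mathfrak p_k(A')=\sum_i a_i^k$ for $k\ge2$; that is, $\mathfrak e_0(A')=1$ and $k\,\mathfrak e_k(A')=\sum_{i=1}^k(-1)^{i-1}\mathfrak e_{k-i}(A')\,\mathfrak p_i(A')$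 for $k \geq 1$. **Theorem C.** There are universal constants $C$ and $D$ (one can take $D=4$ and some $0<C\le570$) with the following two properties. (1) Let $X$ be an $\mathbb N$-valued random variable with law $\mu$, let $\lambda,\tau>0$, and suppose that for all real $\xi$ $$\mathbb E[e^{i\xi X}]\,e^{-\lambda(e^{i\xi}-1)}=1+\sum_{s\ge2}b_s(e^{i\xi}-1)^s,\qquad |b_s|\le\Bigl(\frac{\tau}{\sqrt s}\Bigr)^s\quad(s\ge2),$$ with real $b_s$ and $b_1=0$. If $r\ge1$ and $D\tau/\sqrt\lambda<1$, then $d_{\mathrm{TV}}(\mu,\nu^{(r)}_{\lambda,b})\le C\,(D\tau/\sqrt\lambda)^{r+1}$. (2) Let $(X_n)_{n\in\mathbb N}$ be $\mathbb N$-valued random variables with laws $\mu_n$, $(\lambda_n)$ real numbers, $A$ a square-summable real family, $\sigma=(\sum_{a\in A}a^2)^{1/2}$, $\rho>1$, and $\varepsilon_n\to0$. Suppose that, for every $n$ and every complex $w$ with $|w|<\rho$, $w^{X_n}$ is integrable and $$\Bigl|\mathbb E[w^{X_n}]\,e^{-\lambda_n(w-1)}-\mathfrak E(A',w-1)\Bigr|\le\varepsilon_n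 .$$ Let $\nu^{(r)}_{n,*}=\nu^{(r)}_{\lambda_n,b}$ with $b_s=\mathfrak e_s(A')$ be the derived approximation scheme of order $r\in\mathbb N$. For every $r$ and every $n$ such that $\sqrt{\lambda_n}>D\sqrt e\,\sigma$, $$d_{\mathrm{TV}}(\mu_n,\nu^{(r)}_{n,*})\le C\Bigl(\frac{D\sqrt e\,\sigma}{\sqrt{\lambda_n}}\Bigr)^{r+1}+\varepsilon_n\Bigl(\frac{\rho}{\rho-1}+\lambda_n\Bigr).$$ In particular, if $\lambda_n\to+\infty$ and $\varepsilon_n=O(\lambda_n^{-(r+3)/2})$, then $d_{\mathrm{TV}}(\mu_n,\nu^{(r)}_{n,*})=O(\lambda_n^{-(r+1)/2})$. -/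

import Mathlib

open MeasureTheory Filter Topology Asymptotics

noncomputable section

namespace ModPoisson

/-- The elementary symmetric functions `e_0, e_1, e_2, …` under the specialisation of the algebra
of symmetric functions whose power sums are `p 1, p 2, …`. They are determined by Newton's
identities `k e_k = ∑_{i=1}^k (-1)^(i-1) e_{k-i} p_i`, that is, by
`1 + ∑_{k≥1} e_k z^k = exp (∑_{k≥1} (-1)^(k-1) p_k z^k / k)`; the value `p 0` plays no role. -/
def elemOfPowerSums (p : ℕ → ℝ) : ℕ → ℝ
  | 0 => 1
  | k + 1 => (∑ j : Fin (k + 1),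
      (-1 : ℝ) ^ (k - (j : ℕ)) * elemOfPowerSums p j * p (k + 1 - j)) / (k + 1)

/-- The power sums of the virtual alphabet `A'` attached to a square-summable family
`A = {a 0, a 1, …}`: the first one is set to `0`, the other ones are those of `A`. -/
def virtualPowerSum (a : ℕ → ℝ) (k : ℕ) : ℝ :=
  if k ≤ 1 then 0 else ∑' i, a i ^ k

/-- The coefficients `e_s(A')`. -/
def virtualElem (a : ℕ → ℝ) (s : ℕ) : ℝ :=
  elemOfPowerSums (virtualPowerSum a) s

/-- The entire function `E(A', z) = ∏_i (1 + a_i z) exp (-a_i z)`. -/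
def bernoulliResidue (a : ℕ → ℝ) (z : ℂ) : ℂ :=
  ∏' i, (1 + (a i : ℂ) * z) * Complex.exp (-((a i : ℂ) * z))

/-- `Ψ(w) = 𝔼[w ^ X] exp (-l (w - 1))`. -/
def residue {Ω : Type*} [MeasurableSpace Ω] (P : Measure Ω) (X : Ω → ℕ) (l : ℝ) (w : ℂ) : ℂ :=
  (∫ x, w ^ X x ∂P) * Complex.exp (-((l : ℂ) * (w - 1)))

/-- Mod-Poisson convergence of `(X n)` with parameters `(l n)` and Bernoulli asymptotics given by
the family `a`, on the open disc of radius `ρ`, with remainder `ε`. The generating functions are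
required to exist on that disc. -/
structure ConvergesModPoissonBernoulli {Ω : ℕ → Type*} [∀ n, MeasurableSpace (Ω n)]
    (P : ∀ n, Measure (Ω n)) (X : ∀ n, Ω n → ℕ) (l : ℕ → ℝ) (a : ℕ → ℝ) (ρ : ℝ)
    (ε : ℕ → ℝ) : Prop where
  one_lt_radius : 1 < ρ
  summable_sq : Summable fun i => a i ^ 2
  tendsto_remainder : Tendsto ε atTop (𝓝 0)
  integrable_pow : ∀ n, ∀ w ∈ Metric.ball (0 : ℂ) ρ, Integrable (fun x => w ^ X n x) (P n)
  norm_sub_le : ∀ n, ∀ w ∈ Metric.ball (0 : ℂ) ρ,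
    ‖residue (P n) (X n) (l n) w - bernoulliResidue a (w - 1)‖ ≤ ε n

/-- The mass at `k` of the Poisson law of parameter `l`. -/
def poissonMass (l : ℝ) (k : ℕ) : ℝ :=
  Real.exp (-l) * l ^ k / (k.factorial : ℝ)

/-- The masses of the signed measure on `ℕ` with Fourier transform
`exp (l (e^{iξ} - 1)) (1 + ∑_{s=1}^r b_s (e^{iξ} - 1)^s)`; that this is its Fourier transform is
proved below in `hasSum_approxScheme`. -/
def approxScheme (l : ℝ) (b : ℕ → ℝ) (r : ℕ) (k : ℕ) : ℝ :=
  poissonMass l k + ∑ s ∈ Finset.Icc 1 r, ∑ t ∈ Finset.range (s + 1),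
    (-1 : ℝ) ^ (s - t) * (s.choose t : ℝ) * b s * (if t ≤ k then poissonMass l (k - t) else 0)

/-- The total variation distance between the law of `X` and the signed measure on `ℕ` with
masses `ν k`. -/
def dTV {Ω : Type*} [MeasurableSpace Ω] (P : Measure Ω) (X : Ω → ℕ) (ν : ℕ → ℝ) : ℝ :=
  (1 / 2) * ∑' k, |(P.map X).real {k} - ν k|

theorem hasSum_poissonMass (l : ℝ) (w : ℂ) :
    HasSum (fun k => (poissonMass l k : ℂ) * w ^ k) (Complex.exp (l * (w - 1))) := by
  have h := (NormedSpace.expSeries_div_hasSum_exp ((l : ℂ) * w)).mul_left (Complex.exp (-l))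
  rw [← Complex.exp_eq_exp_ℂ, ← Complex.exp_add] at h
  have e : (-(l : ℂ) + l * w) = l * (w - 1) := by ring
  rw [e] at h
  refine h.congr_fun ?_
  intro k
  simp only [poissonMass]
  push_cast
  rw [mul_pow]
  ring

theorem summable_poissonMass (l : ℝ) : Summable (poissonMass l) := by
  have h := (hasSum_poissonMass l 1).summable
  simp only [one_pow, mul_one] at h
  exact_mod_cast h

theorem hasSum_shift_poissonMass (l : ℝ) (t : ℕ) (w : ℂ) :
    HasSum (fun k => (((if t ≤ k then poissonMass l (k - t) else 0 : ℝ)) : ℂ) * w ^ k)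
      (w ^ t * Complex.exp (l * (w - 1))) := by
  rw [← hasSum_nat_add_iff' t]
  have h0 : ∑ i ∈ Finset.range t,
      (((if t ≤ i then poissonMass l (i - t) else 0 : ℝ)) : ℂ) * w ^ i = 0 := by
    refine Finset.sum_eq_zero fun i hi => ?_
    rw [if_neg (by simpa using hi)]
    simp
  rw [h0, sub_zero]
  refine ((hasSum_poissonMass l w).mul_left (w ^ t)).congr_fun ?_
  intro k
  rw [if_pos (Nat.le_add_left t k), Nat.add_sub_cancel, pow_add]
  ring

/-- The generating function of `approxScheme`; for `w = e^{iξ}` this is its Fourier transform. -/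
theorem hasSum_approxScheme (l : ℝ) (b : ℕ → ℝ) (r : ℕ) (w : ℂ) :
    HasSum (fun k => (approxScheme l b r k : ℂ) * w ^ k)
      (Complex.exp (l * (w - 1)) * (1 + ∑ s ∈ Finset.Icc 1 r, (b s : ℂ) * (w - 1) ^ s)) := by
  have h := (hasSum_poissonMass l w).add
    (hasSum_sum (s := Finset.Icc 1 r) fun s _ =>
      hasSum_sum (s := Finset.range (s + 1)) fun t _ =>
        (hasSum_shift_poissonMass l t w).mul_left
          ((((-1 : ℝ) ^ (s - t) * (s.choose t : ℝ) * b s : ℝ)) : ℂ))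
  convert h using 1
  · funext k
    simp only [approxScheme]
    push_cast
    rw [add_mul, Finset.sum_mul]
    congr 1
    refine Finset.sum_congr rfl fun s _ => ?_
    rw [Finset.sum_mul]
    refine Finset.sum_congr rfl fun t _ => ?_
    ring
  · rw [mul_add, mul_one, Finset.mul_sum]
    congr 1
    refine Finset.sum_congr rfl fun s _ => ?_
    rw [sub_eq_add_neg w 1, add_pow, Finset.mul_sum, Finset.mul_sum]
    refine Finset.sum_congr rfl fun t _ => ?_
    push_cast
    ring

theorem summable_approxScheme (l : ℝ) (b : ℕ → ℝ) (r : ℕ) : Summable (approxScheme l b r) := by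
  have h := (hasSum_approxScheme l b r 1).summable
  simp only [one_pow, mul_one] at h
  exact_mod_cast h

end ModPoisson

end

/-! ### The `ℓ¹` convolution algebra seen through generating functions on the unit circle. -/

namespace ModPoisson

/-! Total variation distance is half an `ℓ¹`-norm, and absolutely summable sequences form a Banach
algebra under convolution, faithfully represented by their generating functions on `|w| = 1`. So it
suffices to write the generating function of the difference in any convenient way, with factors and
summands whose `ℓ¹`-norms are controlled. `GenBound` records such a bound without naming the
sequence; injectivity of the representation (`HasGen.unique`) transfers it to the actual difference
of masses.

The central estimate is that `exp (l (w - 1)) (w - 1)` has norm at most `1 / √l`: it is the mean of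
`|k / l - 1|` under the Poisson law, controlled by the variance. Since `exp (l (w - 1)) (w - 1) ^ s`
is the `s`-th power of the same expression with parameter `l / s`, its norm is at most `(√s / √l) ^
s` (`genBound_exp_mul_pow`). The hypothesis `|b s| ≤ (τ / √s) ^ s` cancels exactly the `√s ^ s`, and
the tail beyond order `r` is dominated by a geometric series of ratio `τ / √l` (`genBound_tail`).

For Bernoulli asymptotics, `|E(A', z)| ≤ exp (σ² |z|² / 2)` and Cauchy's estimate on `|z| = √s / σ`
give that hypothesis with `τ = √e σ`. The Taylor coefficients of `E(A', ·)` are the `e_s(A')`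
because its logarithmic derivative generates the power sums, which is Newton's recursion. The
remainder is holomorphic and bounded by `ε` on a disc of radius `ρ > 1`, so Cauchy's estimate bounds
its `ℓ¹`-norm; multiplying by a Poisson law costs nothing. -/

/-- `f` is absolutely summable and its generating function on the unit circle is `F`. -/
structure HasGen (f : ℕ → ℂ) (F : ℂ → ℂ) : Prop where
  summable : Summable fun k => ‖f k‖
  hasSum : ∀ w : ℂ, ‖w‖ = 1 → HasSum (fun k => f k * w ^ k) (F w)

/-- `F` is, on the unit circle, the generating function of a sequence of `ℓ¹`-norm at most `B`. -/
def GenBound (F : ℂ → ℂ) (B : ℝ) : Prop :=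
  ∃ f, HasGen f F ∧ ∑' k, ‖f k‖ ≤ B

theorem HasGen.congr {f : ℕ → ℂ} {F G : ℂ → ℂ} (h : HasGen f F)
    (hFG : ∀ w, ‖w‖ = 1 → F w = G w) : HasGen f G :=
  ⟨h.summable, fun w hw => hFG w hw ▸ h.hasSum w hw⟩

theorem HasGen.sub {f g : ℕ → ℂ} {F G : ℂ → ℂ} (hf : HasGen f F) (hg : HasGen g G) :
    HasGen (fun k => f k - g k) (fun w => F w - G w) := by
  refine ⟨?_, fun w hw => ?_⟩
  · exact (hf.summable.add hg.summable).of_nonneg_of_le (fun _ => norm_nonneg _)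
      fun k => norm_sub_le _ _
  · simpa only [sub_mul] using (hf.hasSum w hw).sub (hg.hasSum w hw)

theorem integral_exp_int_mul (m : ℤ) (hm : m ≠ 0) :
    ∫ t in (0 : ℝ)..2 * Real.pi, Complex.exp (m * Complex.I * t) = 0 := by
  rw [integral_exp_mul_complex (by simp [hm])]
  have : (m : ℂ) * Complex.I * ((2 * Real.pi : ℝ) : ℂ) = m * (2 * Real.pi * Complex.I) := by
    push_cast; ring
  rw [this, Complex.exp_int_mul_two_pi_mul_I]
  simp

/-- Integrating the series against `exp (-i n t)` over a period isolates the `n`-th coefficient;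
absolute summability justifies integrating term by term. -/
theorem HasGen.eq_zero {f : ℕ → ℂ} (h : HasGen f fun _ => 0) (n : ℕ) : f n = 0 := by
  let u : ℕ → C(ℝ, ℂ) := fun k =>
    ⟨fun t => f k * Complex.exp ((((k : ℤ) - (n : ℤ) : ℤ) : ℂ) * Complex.I * t), by fun_prop⟩
  have hnorm : ∀ k (t : ℝ), ‖u k t‖ = ‖f k‖ := fun k t => by
    have : (((k : ℤ) - (n : ℤ) : ℤ) : ℂ) * Complex.I * t
        = ((((k : ℤ) - (n : ℤ) : ℤ) * t : ℝ) : ℂ) * Complex.I := by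
      push_cast; ring
    simp only [u, ContinuousMap.coe_mk, norm_mul]
    rw [this, Complex.norm_exp_ofReal_mul_I, mul_one]
  have hs : Summable fun k => ‖(u k).restrict
      (⟨Set.uIcc 0 (2 * Real.pi), isCompact_uIcc⟩ : TopologicalSpace.Compacts ℝ)‖ := by
    refine h.summable.of_nonneg_of_le (fun _ => norm_nonneg _) fun k => ?_
    refine (ContinuousMap.norm_le _ (norm_nonneg _)).2 fun t => ?_
    exact (hnorm k t).le
  have key := intervalIntegral.hasSum_intervalIntegral_of_summable_norm hs
  have hz : ∀ t : ℝ, ∑' k, u k t = 0 := fun t => by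
    have h1 := (h.hasSum (Complex.exp (t * Complex.I))
      (Complex.norm_exp_ofReal_mul_I t)).mul_right (Complex.exp (-(n * Complex.I * t)))
    rw [zero_mul] at h1
    rw [← h1.tsum_eq]
    refine tsum_congr fun k => ?_
    simp only [u, ContinuousMap.coe_mk]
    rw [← Complex.exp_nat_mul, mul_assoc (f k), ← Complex.exp_add]
    congr 2
    push_cast; ring
  simp only [hz, intervalIntegral.integral_zero] at key
  have hk : ∀ k, k ≠ n → ∫ t in (0 : ℝ)..2 * Real.pi, u k t = 0 := fun k hkn => by
    simp only [u, ContinuousMap.coe_mk, intervalIntegral.integral_const_mul]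
    rw [integral_exp_int_mul _ (by omega), mul_zero]
  have h2 := key.unique (hasSum_single n hk)
  simp only [u, ContinuousMap.coe_mk, sub_self, Int.cast_zero, zero_mul, Complex.exp_zero,
    mul_one, intervalIntegral.integral_const, sub_zero] at h2
  have hp : (2 * Real.pi : ℝ) ≠ 0 := by positivity
  simpa [Real.pi_ne_zero] using h2.symm

theorem HasGen.unique {f g : ℕ → ℂ} {F : ℂ → ℂ} (hf : HasGen f F) (hg : HasGen g F) : f = g := by
  funext n
  have h := (hf.sub hg).congr (G := fun _ => 0) fun w _ => sub_self _
  exact sub_eq_zero.1 (h.eq_zero n)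

theorem GenBound.tsum_norm_le {f : ℕ → ℂ} {F : ℂ → ℂ} {B : ℝ} (h : GenBound F B)
    (hf : HasGen f F) : ∑' k, ‖f k‖ ≤ B := by
  obtain ⟨g, hg, hB⟩ := h
  rwa [hf.unique hg]

theorem GenBound.congr {F G : ℂ → ℂ} {B : ℝ} (h : GenBound F B)
    (hFG : ∀ w, ‖w‖ = 1 → F w = G w) : GenBound G B := by
  obtain ⟨f, hf, hB⟩ := h
  exact ⟨f, hf.congr hFG, hB⟩

theorem GenBound.mono {F : ℂ → ℂ} {B B' : ℝ} (h : GenBound F B) (hB : B ≤ B') :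
    GenBound F B' := by
  obtain ⟨f, hf, hf'⟩ := h
  exact ⟨f, hf, hf'.trans hB⟩

theorem genBound_one : GenBound (fun _ => 1) 1 := by
  refine ⟨fun k => if k = 0 then 1 else 0, ⟨?_, fun w _ => ?_⟩, ?_⟩
  · exact summable_of_ne_finset_zero (s := {0}) fun k hk => by
      rw [if_neg (by simpa using hk), norm_zero]
  · have := hasSum_single (f := fun k => (if k = 0 then (1 : ℂ) else 0) * w ^ k) 0
      fun k hk => by simp [hk]
    simpa using this
  · rw [tsum_eq_single 0 fun k hk => by simp [hk]]
    simp

theorem GenBound.const_mul {F : ℂ → ℂ} {B : ℝ} (h : GenBound F B) (c : ℂ) :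
    GenBound (fun w => c * F w) (‖c‖ * B) := by
  obtain ⟨f, hf, hB⟩ := h
  refine ⟨fun k => c * f k, ⟨?_, fun w hw => ?_⟩, ?_⟩
  · simpa only [norm_mul] using hf.summable.mul_left _
  · simpa only [mul_assoc] using (hf.hasSum w hw).mul_left c
  · simp only [norm_mul, tsum_mul_left]
    gcongr

theorem GenBound.add {F G : ℂ → ℂ} {B B' : ℝ} (hF : GenBound F B) (hG : GenBound G B') :
    GenBound (fun w => F w + G w) (B + B') := by
  obtain ⟨f, hf, hB⟩ := hF
  obtain ⟨g, hg, hB'⟩ := hG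
  have hs : Summable fun k => ‖f k + g k‖ :=
    (hf.summable.add hg.summable).of_nonneg_of_le (fun _ => norm_nonneg _)
      fun k => norm_add_le _ _
  refine ⟨fun k => f k + g k, ⟨hs, fun w hw => ?_⟩, ?_⟩
  · simpa only [add_mul] using (hf.hasSum w hw).add (hg.hasSum w hw)
  · refine (hs.tsum_le_tsum (fun k => norm_add_le _ _) (hf.summable.add hg.summable)).trans ?_
    rw [hf.summable.tsum_add hg.summable]
    gcongr

theorem HasGen.mul {f g : ℕ → ℂ} {F G : ℂ → ℂ} (hf : HasGen f F) (hg : HasGen g G) :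
    HasGen (fun n => ∑ kl ∈ Finset.HasAntidiagonal.antidiagonal n, f kl.1 * g kl.2)
      (fun w => F w * G w) := by
  refine ⟨summable_norm_sum_mul_antidiagonal_of_summable_norm hf.summable hg.summable,
    fun w hw => ?_⟩
  have hf' : Summable fun k => ‖f k * w ^ k‖ := by simpa [hw] using hf.summable
  have hg' : Summable fun k => ‖g k * w ^ k‖ := by simpa [hw] using hg.summable
  have h := tsum_mul_tsum_eq_tsum_sum_antidiagonal_of_summable_norm hf' hg'
  have hs' := (summable_norm_sum_mul_antidiagonal_of_summable_norm hf' hg').of_norm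
  rw [(hf.hasSum w hw).tsum_eq, (hg.hasSum w hw).tsum_eq] at h
  have h2 := hs'.hasSum
  rw [← h] at h2
  refine h2.congr_fun fun n => ?_
  rw [Finset.sum_mul]
  refine Finset.sum_congr rfl fun kl hkl => ?_
  rw [← Finset.HasAntidiagonal.mem_antidiagonal.1 hkl, pow_add]
  ring

/-- Convolution is submultiplicative for the `ℓ¹`-norm: take norms inside the antidiagonal sums and
refactor. -/
theorem GenBound.mul {F G : ℂ → ℂ} {B B' : ℝ} (hF : GenBound F B) (hG : GenBound G B') :
    GenBound (fun w => F w * G w) (B * B') := by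
  obtain ⟨f, hf, hB⟩ := hF
  obtain ⟨g, hg, hB'⟩ := hG
  refine ⟨_, hf.mul hg, ?_⟩
  have hf' : Summable fun k => ‖‖f k‖‖ := by simpa using hf.summable
  have hg' : Summable fun k => ‖‖g k‖‖ := by simpa using hg.summable
  have h := tsum_mul_tsum_eq_tsum_sum_antidiagonal_of_summable_norm hf' hg'
  have hs' := (summable_norm_sum_mul_antidiagonal_of_summable_norm hf' hg').of_norm
  calc _ ≤ ∑' n, ∑ kl ∈ Finset.HasAntidiagonal.antidiagonal n, ‖f kl.1‖ * ‖g kl.2‖ := by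
        refine (hf.mul hg).summable.tsum_le_tsum (fun n => ?_) hs'
        refine (norm_sum_le _ _).trans_eq ?_
        simp only [norm_mul]
    _ = (∑' k, ‖f k‖) * ∑' k, ‖g k‖ := h.symm
    _ ≤ B * B' := by
        have h0 : 0 ≤ ∑' k, ‖f k‖ := tsum_nonneg fun _ => norm_nonneg _
        have h1 : 0 ≤ ∑' k, ‖g k‖ := tsum_nonneg fun _ => norm_nonneg _
        exact mul_le_mul hB hB' h1 (h0.trans hB)

theorem GenBound.pow {F : ℂ → ℂ} {B : ℝ} (h : GenBound F B) (n : ℕ) :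
    GenBound (fun w => F w ^ n) (B ^ n) := by
  induction n with
  | zero => simpa using genBound_one
  | succ n ih => simpa only [pow_succ] using ih.mul h

/-- Completeness of the algebra in concrete form: the double family of coefficients is absolutely
summable, so rows and columns may be exchanged. -/
theorem genBound_of_hasSum {F : ℕ → ℂ → ℂ} {B : ℕ → ℝ} {G : ℂ → ℂ}
    (h : ∀ s, GenBound (F s) (B s)) (hB : Summable B)
    (hG : ∀ w, ‖w‖ = 1 → HasSum (fun s => F s w) (G w)) : GenBound G (∑' s, B s) := by
  choose f hf hfB using h
  have h1 : Summable fun s => ∑' k, ‖f s k‖ :=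
    hB.of_nonneg_of_le (fun s => tsum_nonneg fun _ => norm_nonneg _) hfB
  have h2 : Summable fun p : ℕ × ℕ => ‖f p.1 p.2‖ :=
    (summable_prod_of_nonneg fun _ => norm_nonneg _).2 ⟨fun s => (hf s).summable, h1⟩
  have h2' : Summable fun p : ℕ × ℕ => ‖f p.2 p.1‖ := h2.prod_symm
  have h3 : ∀ k, Summable fun s => ‖f s k‖ := h2'.prod_factor
  have h4 : Summable fun k => ∑' s, ‖f s k‖ := h2'.prod
  have h5 : ∀ k, ‖∑' s, f s k‖ ≤ ∑' s, ‖f s k‖ := fun k => norm_tsum_le_tsum_norm (h3 k)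
  have h6 : Summable fun k => ‖∑' s, f s k‖ := h4.of_nonneg_of_le (fun _ => norm_nonneg _) h5
  refine ⟨fun k => ∑' s, f s k, ⟨h6, fun w hw => ?_⟩, ?_⟩
  · have hs : Summable fun p : ℕ × ℕ => f p.1 p.2 * w ^ p.2 := by
      refine Summable.of_norm ?_
      simpa only [norm_mul, norm_pow, hw, one_pow, mul_one] using h2
    have h7 : HasSum (fun p : ℕ × ℕ => f p.1 p.2 * w ^ p.2) (G w) := by
      obtain ⟨S, hS⟩ := hs
      have h' : HasSum (fun s => F s w) S :=
        HasSum.prod_fiberwise (f := fun p : ℕ × ℕ => f p.1 p.2 * w ^ p.2) hS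
          fun s => (hf s).hasSum w hw
      rwa [(hG w hw).unique h']
    have h8 : HasSum (fun p : ℕ × ℕ => f p.2 p.1 * w ^ p.1) (G w) :=
      (Equiv.prodComm ℕ ℕ).hasSum_iff (f := fun p : ℕ × ℕ => f p.1 p.2 * w ^ p.2).2 h7
    refine HasSum.prod_fiberwise (f := fun p : ℕ × ℕ => f p.2 p.1 * w ^ p.1) h8 fun k => ?_
    have h9 : Summable fun s => f s k := Summable.of_norm (h3 k)
    exact h9.hasSum.mul_right (w ^ k)
  · calc ∑' k, ‖∑' s, f s k‖ ≤ ∑' k, ∑' s, ‖f s k‖ := h6.tsum_le_tsum h5 h4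
      _ = ∑' s, ∑' k, ‖f s k‖ := h2.tsum_comm
      _ ≤ ∑' s, B s := h1.tsum_le_tsum hfB hB

theorem hasSum_of_eq {E : Type*} [AddCommMonoid E] [TopologicalSpace E] {f g : ℕ → E} {a b : E}
    (h : HasSum f a) (hfg : ∀ k, g k = f k) (hab : b = a) : HasSum g b := by
  rwa [funext hfg, hab]

/-! ### Poisson moments and the norms of `exp (l (w - 1)) (w - 1) ^ s`. -/

theorem poissonMass_nonneg {l : ℝ} (hl : 0 ≤ l) (k : ℕ) : 0 ≤ poissonMass l k := by
  unfold poissonMass; positivity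

theorem hasSum_poissonMass_one (l : ℝ) : HasSum (poissonMass l) 1 := by
  have h := hasSum_poissonMass l 1
  simp only [one_pow, mul_one, sub_self, mul_zero, Complex.exp_zero] at h
  exact Complex.hasSum_ofReal.1 (by simpa using h)

theorem genBound_exp {l : ℝ} (hl : 0 ≤ l) :
    GenBound (fun w => Complex.exp (l * (w - 1))) 1 := by
  have e : ∀ k, ‖(poissonMass l k : ℂ)‖ = poissonMass l k := fun k => by
    rw [Complex.norm_real, Real.norm_of_nonneg (poissonMass_nonneg hl k)]
  refine ⟨fun k => poissonMass l k, ⟨?_, fun w _ => hasSum_poissonMass l w⟩, ?_⟩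
  · simpa only [e] using summable_poissonMass l
  · simp only [e, (hasSum_poissonMass_one l).tsum_eq, le_refl]

theorem succ_mul_poissonMass_succ (l : ℝ) (k : ℕ) :
    ((k : ℝ) + 1) * poissonMass l (k + 1) = l * poissonMass l k := by
  have : (k.factorial : ℝ) ≠ 0 := by positivity
  unfold poissonMass
  rw [Nat.factorial_succ]
  push_cast
  field_simp
  ring

theorem hasSum_mul_poissonMass (l : ℝ) : HasSum (fun k : ℕ => (k : ℝ) * poissonMass l k) l := by
  rw [← hasSum_nat_add_iff' 1]
  simp only [Finset.range_one, Finset.sum_singleton, Nat.cast_zero, zero_mul, sub_zero,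
    Nat.cast_add, Nat.cast_one, succ_mul_poissonMass_succ]
  simpa using (hasSum_poissonMass_one l).mul_left l

theorem hasSum_sq_mul_poissonMass (l : ℝ) :
    HasSum (fun k : ℕ => (k : ℝ) ^ 2 * poissonMass l k) (l ^ 2 + l) := by
  rw [← hasSum_nat_add_iff' 1]
  simp only [Finset.range_one, Finset.sum_singleton, Nat.cast_zero, Nat.cast_add, Nat.cast_one]
  have h := ((hasSum_mul_poissonMass l).mul_left l).add ((hasSum_poissonMass_one l).mul_left l)
  refine hasSum_of_eq h (fun k => ?_) ?_
  · rw [sq, mul_assoc, succ_mul_poissonMass_succ]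
    ring
  · ring

theorem hasSum_variance_poissonMass {l : ℝ} (hl : 0 < l) :
    HasSum (fun k : ℕ => ((k : ℝ) / l - 1) ^ 2 * poissonMass l k) (1 / l) := by
  have h := (((hasSum_sq_mul_poissonMass l).mul_left (1 / l ^ 2)).sub
    ((hasSum_mul_poissonMass l).mul_left (2 / l))).add (hasSum_poissonMass_one l)
  refine hasSum_of_eq h (fun k => ?_) ?_
  · field_simp
    ring
  · field_simp
    ring

/-- The coefficient at `k` is `(k / l - 1)` times the Poisson mass, so the norm is a mean absolute
deviation, at most the standard deviation `1 / √l`. -/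
theorem genBound_exp_mul_sub_one {l : ℝ} (hl : 0 < l) :
    GenBound (fun w => Complex.exp (l * (w - 1)) * (w - 1)) (1 / √l) := by
  have hr : 0 < √l := Real.sqrt_pos.2 hl
  have hsq : √l * √l = l := Real.mul_self_sqrt hl.le
  have hcoe : ∀ k : ℕ, ((if 1 ≤ k then poissonMass l (k - 1) else 0 : ℝ) : ℂ) - poissonMass l k
      = (((k : ℝ) / l - 1) * poissonMass l k : ℝ) := fun k => by
    rw [← Complex.ofReal_sub]
    congr 1
    rcases k with _ | k
    · simp
    · have := succ_mul_poissonMass_succ l k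
      simp only [Nat.le_add_left, if_true, Nat.add_sub_cancel]
      push_cast
      field_simp
      linarith
  have hle : ∀ k : ℕ, ‖(((((k : ℝ) / l - 1) * poissonMass l k : ℝ)) : ℂ)‖
      ≤ √l / 2 * (((k : ℝ) / l - 1) ^ 2 * poissonMass l k) + 1 / (2 * √l) * poissonMass l k :=
    fun k => by
      have hp := poissonMass_nonneg hl.le k
      rw [Complex.norm_real, Real.norm_eq_abs, abs_mul, abs_of_nonneg hp]
      -- AM-GM replaces Cauchy–Schwarz. The weights are chosen so that, the variance being `1 / l`,
      -- each term contributes `1 / (2 √l)`.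
      have h0 : |(k : ℝ) / l - 1| ≤ √l / 2 * ((k : ℝ) / l - 1) ^ 2 + 1 / (2 * √l) := by
        rw [← sq_abs]
        set x := |(k : ℝ) / l - 1|
        have : √l / 2 * x ^ 2 + 1 / (2 * √l) - x = (√l * x - 1) ^ 2 / (2 * √l) := by
          field_simp
          ring
        have h' : 0 ≤ (√l * x - 1) ^ 2 / (2 * √l) := by positivity
        linarith
      calc _ ≤ (√l / 2 * ((k : ℝ) / l - 1) ^ 2 + 1 / (2 * √l)) * poissonMass l k := by gcongr
        _ = _ := by ring
  have hS := ((hasSum_variance_poissonMass hl).mul_left (√l / 2)).add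
    ((hasSum_poissonMass_one l).mul_left (1 / (2 * √l)))
  have hsum := hS.summable.of_nonneg_of_le (fun _ => norm_nonneg _) hle
  refine ⟨_, ⟨hsum, fun w _ => ?_⟩, ?_⟩
  · have h := (hasSum_shift_poissonMass l 1 w).sub (hasSum_poissonMass l w)
    refine hasSum_of_eq h (fun k => ?_) ?_
    · rw [← hcoe, sub_mul]
    · ring
  · refine (hsum.tsum_le_tsum hle hS.summable).trans_eq ?_
    rw [hS.tsum_eq, ← hsq]
    field_simp
    rw [Real.sqrt_sq hr.le]
    ring

/-- Split the Poisson parameter into `s` equal parts, one for each factor `w - 1`, and use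
submultiplicativity. -/
theorem genBound_exp_mul_pow {l : ℝ} (hl : 0 < l) {s : ℕ} (hs : 1 ≤ s) :
    GenBound (fun w => Complex.exp (l * (w - 1)) * (w - 1) ^ s) ((√s / √l) ^ s) := by
  have hs0 : (0 : ℝ) < s := by exact_mod_cast hs
  have h := (genBound_exp_mul_sub_one (div_pos hl hs0)).pow s
  rw [Real.sqrt_div hl.le, one_div_div] at h
  refine h.congr fun w _ => ?_
  rw [mul_pow, ← Complex.exp_nat_mul]
  congr 2
  have : (s : ℂ) ≠ 0 := by exact_mod_cast hs0.ne'
  push_cast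
  field_simp

/-- The `ℓ¹`-norm of the tail of an expansion in powers of `w - 1` against a Poisson law. -/
theorem genBound_tail {l τ : ℝ} (hl : 0 < l) (hτ : 0 ≤ τ) {b : ℕ → ℝ} {r : ℕ}
    (hb : ∀ s : ℕ, r + 1 ≤ s → |b s| ≤ (τ / √(s : ℝ)) ^ s) (hx : τ / √l < 1) {G : ℂ → ℂ}
    (hG : ∀ w : ℂ, ‖w‖ = 1 → HasSum (fun s : ℕ => (b (s + (r + 1)) : ℂ) * (w - 1) ^ (s + (r + 1)))
      (G w)) :
    GenBound (fun w => Complex.exp (l * (w - 1)) * G w)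
      ((τ / √l) ^ (r + 1) * (1 - τ / √l)⁻¹) := by
  have hx0 : 0 ≤ τ / √l := by positivity
  have hgeo := (hasSum_geometric_of_lt_one hx0 hx).mul_left ((τ / √l) ^ (r + 1))
  rw [← hgeo.tsum_eq]
  refine genBound_of_hasSum (F := fun s w => (b (s + (r + 1)) : ℂ) *
    (Complex.exp (l * (w - 1)) * (w - 1) ^ (s + (r + 1)))) (fun s => ?_) hgeo.summable
    fun w hw => ?_
  · refine ((genBound_exp_mul_pow hl (s := s + (r + 1)) (by omega)).const_mul _).mono ?_
    rw [Complex.norm_real, Real.norm_eq_abs, ← pow_add, add_comm (r + 1) s]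
    have hs : 0 < √((s + (r + 1) : ℕ) : ℝ) := Real.sqrt_pos.2 (by positivity)
    -- The square roots of the index cancel, leaving `(τ / √l) ^ (s + (r + 1))`.
    calc _ ≤ (τ / √((s + (r + 1) : ℕ) : ℝ)) ^ (s + (r + 1))
          * (√((s + (r + 1) : ℕ) : ℝ) / √l) ^ (s + (r + 1)) := by
          gcongr
          exact hb _ (by omega)
      _ = _ := by
          rw [← mul_pow]
          congr 1
          field_simp
  · refine ((hG w hw).mul_left (Complex.exp (l * (w - 1)))).congr_fun fun s => ?_
    ring

/-! ### From generating functions to total variation; the first approximation bound. -/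

section Law

variable {Ω : Type*} [MeasurableSpace Ω] {P : Measure Ω} {X : Ω → ℕ}

theorem hasSum_integral_pow (hX : Measurable X) {w : ℂ}
    (hw : Integrable (fun x => w ^ X x) P) :
    HasSum (fun k : ℕ => ((P.map X).real {k} : ℂ) * w ^ k) (∫ x, w ^ X x ∂P) := by
  have hm : ∀ k : ℕ, MeasurableSet (X ⁻¹' {k}) := fun k => hX (measurableSet_singleton k)
  have hd : Pairwise (Function.onFun Disjoint fun k : ℕ => X ⁻¹' {k}) := fun i j hij =>
    Disjoint.preimage X (by simpa using hij)
  have hU : ⋃ k : ℕ, X ⁻¹' {k} = Set.univ := by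
    ext x; simp
  have h := hasSum_integral_iUnion hm hd (f := fun x => w ^ X x) (μ := P)
    (by rw [hU]; exact hw.integrableOn)
  rw [hU, setIntegral_univ] at h
  refine h.congr_fun fun k => ?_
  rw [setIntegral_congr_fun (g := fun _ => w ^ k) (hm k) fun x hx => by
    simp only [Set.mem_preimage, Set.mem_singleton_iff] at hx
    simp only [hx], setIntegral_const, Complex.real_smul,
    map_measureReal_apply hX (measurableSet_singleton k)]

theorem summable_map_real [IsFiniteMeasure P] (hX : Measurable X) :
    Summable fun k : ℕ => (P.map X).real {k} := by
  have h := (hasSum_integral_pow (P := P) hX (w := 1)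
    (by simp only [one_pow]; exact integrable_const _)).summable
  simp only [one_pow, mul_one] at h
  exact_mod_cast h

theorem hasGen_law [IsFiniteMeasure P] (hX : Measurable X) :
    HasGen (fun k => ((P.map X).real {k} : ℂ)) fun w => ∫ x, w ^ X x ∂P := by
  refine ⟨?_, fun w hw => hasSum_integral_pow hX ?_⟩
  · simpa [Complex.norm_real] using (summable_map_real (P := P) hX).abs
  · refine Integrable.of_bound (C := 1) ?_ (ae_of_all _ fun x => by simp [hw])
    have h : Measurable fun x => w ^ X x := (measurable_from_nat (f := fun k => w ^ k)).comp hX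
    exact h.aestronglyMeasurable

theorem hasGen_approxScheme (l : ℝ) (b : ℕ → ℝ) (r : ℕ) :
    HasGen (fun k => (approxScheme l b r k : ℂ)) fun w =>
      Complex.exp (l * (w - 1)) * (1 + ∑ s ∈ Finset.Icc 1 r, (b s : ℂ) * (w - 1) ^ s) :=
  ⟨by simpa [Complex.norm_real] using (summable_approxScheme l b r).abs,
    fun w _ => hasSum_approxScheme l b r w⟩

theorem dTV_le_of_genBound [IsFiniteMeasure P] (hX : Measurable X) {l : ℝ} {b : ℕ → ℝ} {r : ℕ}
    {B : ℝ} (h : GenBound (fun w => (∫ x, w ^ X x ∂P) -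
      Complex.exp (l * (w - 1)) * (1 + ∑ s ∈ Finset.Icc 1 r, (b s : ℂ) * (w - 1) ^ s)) B) :
    dTV P X (approxScheme l b r) ≤ 1 / 2 * B := by
  have h1 := h.tsum_norm_le ((hasGen_law (P := P) (X := X) hX).sub (hasGen_approxScheme l b r))
  simp only [← Complex.ofReal_sub, Complex.norm_real, Real.norm_eq_abs] at h1
  unfold dTV
  gcongr

theorem integral_pow_eq_exp_mul_residue (l : ℝ) (w : ℂ) :
    ∫ x, w ^ X x ∂P = Complex.exp (l * (w - 1)) * residue P X l w := by
  rw [residue, mul_left_comm, ← Complex.exp_add, add_neg_cancel, Complex.exp_zero, mul_one]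

end Law

/-- The half from the total variation distance absorbs `(1 - x)⁻¹ ≤ 2`, so the multiplicative
constant is `1`; the factor `4` is more than this argument needs. -/
theorem half_geometric_tail_le {x : ℝ} (hx0 : 0 ≤ x) (hx : 4 * x < 1) (r : ℕ) :
    1 / 2 * (x ^ (r + 1) * (1 - x)⁻¹) ≤ (4 * x) ^ (r + 1) := by
  have h1 : (1 - x)⁻¹ ≤ 2 := by
    rw [inv_le_comm₀ (by linarith) two_pos]
    linarith
  calc 1 / 2 * (x ^ (r + 1) * (1 - x)⁻¹) ≤ 1 / 2 * (x ^ (r + 1) * 2) := by gcongr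
    _ = x ^ (r + 1) := by ring
    _ ≤ (4 * x) ^ (r + 1) := by gcongr; linarith

theorem hasSum_tail_of_hasSum_succ {u : ℕ → ℂ} {S : ℂ} (h : HasSum (fun s => u (s + 1)) S)
    (r : ℕ) : HasSum (fun s => u (s + (r + 1))) (S - ∑ s ∈ Finset.Icc 1 r, u s) := by
  have h1 := (hasSum_nat_add_iff' r).2 h
  have e : ∑ i ∈ Finset.range r, u (i + 1) = ∑ s ∈ Finset.Icc 1 r, u s := by
    rw [Finset.range_eq_Ico, Finset.sum_Ico_add' u 0 r 1, zero_add]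
    rfl
  rw [e] at h1
  exact h1

theorem dTV_approxScheme_le {Ω : Type*} [MeasurableSpace Ω] {P : Measure Ω} [IsFiniteMeasure P]
    {X : Ω → ℕ} (hX : Measurable X) {l τ : ℝ} {b : ℕ → ℝ} (hl : 0 < l) (hτ : 0 ≤ τ) {r : ℕ}
    (hb : ∀ s : ℕ, r + 1 ≤ s → |b s| ≤ (τ / √(s : ℝ)) ^ s)
    (h : ∀ w : ℂ, ‖w‖ = 1 → HasSum (fun s : ℕ => (b (s + 1) : ℂ) * (w - 1) ^ (s + 1))
      (residue P X l w - 1)) (hx : 4 * τ / √l < 1) :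
    dTV P X (approxScheme l b r) ≤ (4 * τ / √l) ^ (r + 1) := by
  rw [mul_div_assoc] at hx ⊢
  have hx0 : 0 ≤ τ / √l := by positivity
  refine le_trans ?_ (half_geometric_tail_le hx0 hx r)
  refine dTV_le_of_genBound hX ?_
  refine (genBound_tail hl hτ hb (by linarith) fun w hw =>
    hasSum_tail_of_hasSum_succ (u := fun s => (b s : ℂ) * (w - 1) ^ s) (h w hw) r).congr
    fun w _ => ?_
  rw [integral_pow_eq_exp_mul_residue l]
  ring

/-! ### The product `E(A', z)`: convergence, holomorphy and growth. -/

/-- The factor `(1 + c z) exp (-c z)` of `bernoulliResidue`. -/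
noncomputable def residueFactor (c : ℝ) (z : ℂ) : ℂ :=
  (1 + (c : ℂ) * z) * Complex.exp (-((c : ℂ) * z))

theorem differentiable_residueFactor (c : ℝ) : Differentiable ℂ (residueFactor c) := by
  unfold residueFactor; fun_prop

theorem norm_one_add_mul_exp_neg_sub_one_le {u : ℂ} (hu : ‖u‖ ≤ 1) :
    ‖(1 + u) * Complex.exp (-u) - 1‖ ≤ 3 * ‖u‖ ^ 2 := by
  have h : (1 + u) * Complex.exp (-u) - 1 = -(Complex.exp (-u) * (Complex.exp u - 1 - u)) := by
    have : Complex.exp (-u) * Complex.exp u = 1 := by rw [← Complex.exp_add]; simp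
    linear_combination this
  rw [h, norm_neg, norm_mul]
  have h1 : ‖Complex.exp (-u)‖ ≤ 3 := by
    rw [Complex.norm_exp]
    have : (-u).re ≤ 1 := (Complex.re_le_norm _).trans (by rwa [norm_neg])
    exact (Real.exp_le_exp.2 this).trans (Real.exp_one_lt_d9.le.trans (by norm_num))
  exact mul_le_mul h1 (Complex.norm_exp_sub_one_sub_id_le hu) (norm_nonneg _) (by norm_num)

/-- `|1 + u|² = 1 + 2 Re u + |u|² ≤ exp (2 Re u + |u|²)`, and `|exp (-u)|²` cancels the linear term.
-/
theorem norm_one_add_mul_exp_neg_le (u : ℂ) :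
    ‖(1 + u) * Complex.exp (-u)‖ ≤ Real.exp (‖u‖ ^ 2 / 2) := by
  refine le_of_sq_le_sq ?_ (Real.exp_pos _).le
  rw [norm_mul, mul_pow, Complex.norm_exp, ← Real.exp_nat_mul, ← Real.exp_nat_mul,
    Complex.sq_norm, Complex.sq_norm, Complex.normSq_apply, Complex.normSq_apply]
  simp only [Complex.add_re, Complex.one_re, Complex.add_im, Complex.one_im, Complex.neg_re,
    zero_add, Nat.cast_ofNat]
  have h := Real.add_one_le_exp (2 * u.re + (u.re * u.re + u.im * u.im))
  calc _ ≤ Real.exp (2 * u.re + (u.re * u.re + u.im * u.im)) * Real.exp (2 * -u.re) := by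
        gcongr
        linarith
    _ = _ := by
        rw [← Real.exp_add]
        congr 1
        ring

variable {a : ℕ → ℝ}

theorem abs_le_sqrt_tsum_sq (ha : Summable fun i => a i ^ 2) (i : ℕ) :
    |a i| ≤ √(∑' i, a i ^ 2) :=
  Real.abs_le_sqrt (ha.le_tsum i fun _ _ => sq_nonneg _)

theorem bernoulliResidue_eq_tprod (a : ℕ → ℝ) :
    bernoulliResidue a = fun z => ∏' i, residueFactor (a i) z := rfl

/-- Each factor is `1 + O(a_i²)` uniformly on the disc once `R |a_i| ≤ 1`, which holds for all but
finitely many `i`. -/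
theorem multipliableLocallyUniformlyOn_residueFactor (ha : Summable fun i => a i ^ 2) (R : ℝ) :
    MultipliableLocallyUniformlyOn (fun i z => residueFactor (a i) z) (Metric.ball 0 R) := by
  have h := Summable.multipliableLocallyUniformlyOn_nat_one_add
    (f := fun i z => residueFactor (a i) z - 1) (K := Metric.ball (0 : ℂ) R)
    (u := fun i => 3 * R ^ 2 * a i ^ 2) Metric.isOpen_ball (ha.mul_left _) ?_ fun i =>
      ((differentiable_residueFactor (a i)).continuous.sub continuous_const).continuousOn
  · simpa only [add_sub_cancel] using h
  · have h0 : Tendsto (fun i => R ^ 2 * a i ^ 2) atTop (𝓝 (R ^ 2 * 0)) :=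
      ha.tendsto_atTop_zero.const_mul _
    rw [mul_zero] at h0
    filter_upwards [h0.eventually (gt_mem_nhds one_pos)] with i hi z hz
    have hz' : ‖z‖ < R := by simpa using hz
    have h1 : ‖(a i : ℂ) * z‖ ^ 2 ≤ R ^ 2 * a i ^ 2 := by
      rw [norm_mul, mul_pow, Complex.norm_real, Real.norm_eq_abs, sq_abs, mul_comm]
      gcongr
    have h2 : ‖(a i : ℂ) * z‖ ≤ 1 := by
      refine (sq_le_one_iff₀ (norm_nonneg _)).1 (h1.trans hi.le)
    refine (norm_one_add_mul_exp_neg_sub_one_le h2).trans ?_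
    nlinarith

theorem hasProd_bernoulliResidue (ha : Summable fun i => a i ^ 2) (z : ℂ) :
    HasProd (fun i => residueFactor (a i) z) (bernoulliResidue a z) :=
  (multipliableLocallyUniformlyOn_residueFactor ha (‖z‖ + 1)).hasProdLocallyUniformlyOn.hasProd
    (by simp)

theorem differentiable_bernoulliResidue (ha : Summable fun i => a i ^ 2) :
    Differentiable ℂ (bernoulliResidue a) := fun z => by
  have h := (multipliableLocallyUniformlyOn_residueFactor ha
    (‖z‖ + 1)).hasProdLocallyUniformlyOn.differentiableOn
    (.of_forall fun s => by
      simpa [Finset.prod_fn] using DifferentiableOn.finsetProd fun i (_ : i ∈ s) =>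
        (differentiable_residueFactor (a i)).differentiableOn) Metric.isOpen_ball
  exact h.differentiableAt (Metric.isOpen_ball.mem_nhds (by simp))

theorem bernoulliResidue_zero (a : ℕ → ℝ) : bernoulliResidue a 0 = 1 := by
  simp [bernoulliResidue]

theorem norm_bernoulliResidue_le (ha : Summable fun i => a i ^ 2) (z : ℂ) :
    ‖bernoulliResidue a z‖ ≤ Real.exp ((∑' i, a i ^ 2) * ‖z‖ ^ 2 / 2) := by
  refine le_of_tendsto (hasProd_bernoulliResidue ha z).norm (.of_forall fun s => ?_)
  calc ∏ i ∈ s, ‖residueFactor (a i) z‖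
      ≤ ∏ i ∈ s, Real.exp (a i ^ 2 * ‖z‖ ^ 2 / 2) := by
        refine Finset.prod_le_prod (fun _ _ => norm_nonneg _) fun i _ => ?_
        refine (norm_one_add_mul_exp_neg_le _).trans_eq ?_
        rw [norm_mul, mul_pow, Complex.norm_real, Real.norm_eq_abs, sq_abs]
    _ = Real.exp ((∑ i ∈ s, a i ^ 2) * ‖z‖ ^ 2 / 2) := by
        rw [← Real.exp_sum, Finset.sum_mul, Finset.sum_div]
    _ ≤ _ := by
        gcongr
        exact ha.sum_le_tsum s fun _ _ => sq_nonneg _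

/-! ### The logarithmic derivative near `0` and the power sums of `A'`. -/

theorem one_add_ne_zero_of_norm_le {u : ℂ} (hu : ‖u‖ ≤ 1 / 2) : 1 + u ≠ 0 := fun h => by
  have : u = -1 := by linear_combination h
  norm_num [this] at hu

theorem logDeriv_residueFactor {c : ℝ} {z : ℂ} (hz : 1 + (c : ℂ) * z ≠ 0) :
    logDeriv (residueFactor c) z = -((c : ℂ) ^ 2 * z) / (1 + (c : ℂ) * z) := by
  have h1 : HasDerivAt (fun z : ℂ => (c : ℂ) * z) c z := by
    simpa using (hasDerivAt_id z).const_mul (c : ℂ)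
  have h : HasDerivAt (residueFactor c) _ z := (h1.const_add 1).mul h1.neg.cexp
  rw [logDeriv_apply, h.deriv, residueFactor, div_eq_div_iff
    (mul_ne_zero hz (Complex.exp_ne_zero _)) hz]
  simp only [Pi.neg_apply]
  ring

/-- The logarithmic derivative of `bernoulliResidue a` as a sum over the family. -/
noncomputable def residueLogDeriv (a : ℕ → ℝ) (z : ℂ) : ℂ :=
  ∑' i, -((a i : ℂ) ^ 2 * z) / (1 + (a i : ℂ) * z)

/-- Expand each term as a geometric series in `-a_i z` and sum over `i` first. No first power sum
occurs, since the exponential factors removed it. -/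
theorem summable_and_hasSum_residueLogDeriv (ha : Summable fun i => a i ^ 2) {z : ℂ}
    (hz : √(∑' i, a i ^ 2) * ‖z‖ ≤ 1 / 2) :
    Summable (fun i => -((a i : ℂ) ^ 2 * z) / (1 + (a i : ℂ) * z)) ∧
    HasSum (fun m : ℕ => (-1) ^ (m + 1) * (virtualPowerSum a (m + 2) : ℂ) * z ^ (m + 1))
      (residueLogDeriv a z) := by
  let u : ℕ × ℕ → ℂ := fun p => (-1) ^ (p.2 + 1) * (a p.1 : ℂ) ^ (p.2 + 2) * z ^ (p.2 + 1)
  have haz : ∀ i, ‖(a i : ℂ) * z‖ ≤ 1 / 2 := fun i => by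
    rw [norm_mul, Complex.norm_real, Real.norm_eq_abs]
    exact le_trans (by gcongr; exact abs_le_sqrt_tsum_sq ha i) hz
  -- Two powers of `a_i` give summability in `i`; the remaining ones pair with `z` to give decay `2
  -- ^ (-m)`.
  have hs : Summable u := by
    have hg : Summable fun m : ℕ => ‖z‖ * (1 / 2 : ℝ) ^ m :=
      (summable_geometric_of_lt_one (by norm_num) (by norm_num)).mul_left _
    refine Summable.of_norm_bounded (ha.mul_of_nonneg hg (fun i => sq_nonneg _)
      fun m => by positivity) fun p => ?_
    have e : ‖u p‖ = a p.1 ^ 2 * (‖z‖ * ‖(a p.1 : ℂ) * z‖ ^ p.2) := by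
      simp only [u, norm_mul, norm_pow, norm_neg, norm_one, one_pow, one_mul, Complex.norm_real,
        Real.norm_eq_abs]
      rw [← sq_abs (a p.1)]
      ring
    rw [e]
    gcongr
    exact haz _
  have h1 : ∀ i, HasSum (fun m => u (i, m)) (-((a i : ℂ) ^ 2 * z) / (1 + (a i : ℂ) * z)) :=
    fun i => by
      have h := (hasSum_geometric_of_norm_lt_one (ξ := -((a i : ℂ) * z))
        (by rw [norm_neg]; linarith [haz i])).mul_left (-((a i : ℂ) ^ 2 * z))
      rw [sub_neg_eq_add, ← div_eq_mul_inv] at h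
      refine h.congr_fun fun m => ?_
      simp only [u]
      rw [neg_pow]
      ring
  have h2 := hs.hasSum.prod_fiberwise h1
  have h3 : HasSum (fun p : ℕ × ℕ => u (p.2, p.1)) (∑' p, u p) :=
    (Equiv.prodComm ℕ ℕ).hasSum_iff (f := u).2 hs.hasSum
  refine ⟨h2.summable, ?_⟩
  rw [residueLogDeriv, h2.tsum_eq]
  refine HasSum.prod_fiberwise (f := fun p : ℕ × ℕ => u (p.2, p.1)) h3 fun m => ?_
  have h4 : Summable fun i => a i ^ (m + 2) := by
    refine Summable.of_norm_bounded (ha.mul_right (√(∑' i, a i ^ 2) ^ m)) fun i => ?_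
    rw [norm_pow, Real.norm_eq_abs, pow_add, sq_abs, mul_comm]
    gcongr
    exact abs_le_sqrt_tsum_sq ha i
  have h5 : HasSum (fun i => (a i : ℂ) ^ (m + 2)) (virtualPowerSum a (m + 2) : ℂ) := by
    have := Complex.hasSum_ofReal.2 h4.hasSum
    simpa [virtualPowerSum] using this
  exact (h5.mul_left ((-1) ^ (m + 1))).mul_right (z ^ (m + 1))

theorem hasSum_residueLogDeriv (ha : Summable fun i => a i ^ 2) {z : ℂ}
    (hz : √(∑' i, a i ^ 2) * ‖z‖ ≤ 1 / 2) :
    HasSum (fun m : ℕ => (-1) ^ m * (virtualPowerSum a (m + 1) : ℂ) * z ^ m)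
      (residueLogDeriv a z) := by
  rw [← hasSum_nat_add_iff' 1]
  simpa [virtualPowerSum] using (summable_and_hasSum_residueLogDeriv ha hz).2

/-- The condition on `z` keeps every factor nonzero, hence also the product, so logarithmic
differentiation is legitimate termwise. -/
theorem deriv_bernoulliResidue (ha : Summable fun i => a i ^ 2) {z : ℂ}
    (hz : √(∑' i, a i ^ 2) * ‖z‖ ≤ 1 / 2) :
    deriv (bernoulliResidue a) z = bernoulliResidue a z * residueLogDeriv a z := by
  have haz : ∀ i, ‖(a i : ℂ) * z‖ ≤ 1 / 2 := fun i => by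
    rw [norm_mul, Complex.norm_real, Real.norm_eq_abs]
    exact le_trans (by gcongr; exact abs_le_sqrt_tsum_sq ha i) hz
  have h1 : ∀ i, 1 + (a i : ℂ) * z ≠ 0 := fun i => one_add_ne_zero_of_norm_le (haz i)
  have hne : ∀ i, residueFactor (a i) z ≠ 0 := fun i =>
    mul_ne_zero (h1 i) (Complex.exp_ne_zero _)
  have hE : ∏' i, residueFactor (a i) z ≠ 0 := by
    have h := tprod_one_add_ne_zero_of_summable (f := fun i => residueFactor (a i) z - 1)
      (fun i => by simpa using hne i) ?_
    · simpa only [add_sub_cancel] using h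
    · refine (ha.mul_left (3 * ‖z‖ ^ 2)).of_nonneg_of_le (fun _ => norm_nonneg _) fun i => ?_
      refine (norm_one_add_mul_exp_neg_sub_one_le ((haz i).trans (by norm_num))).trans_eq ?_
      rw [norm_mul, Complex.norm_real, Real.norm_eq_abs, mul_pow, sq_abs]
      ring
  have hl : ∀ i, logDeriv (residueFactor (a i)) z = _ := fun i => logDeriv_residueFactor (h1 i)
  have h := logDeriv_tprod_eq_tsum (f := fun i => residueFactor (a i)) Metric.isOpen_ball
    (x := z) (s := Metric.ball 0 (‖z‖ + 1)) (by simp) hne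
    (fun i => (differentiable_residueFactor (a i)).differentiableOn)
    (by simp only [hl]; exact (summable_and_hasSum_residueLogDeriv ha hz).1)
    (multipliableLocallyUniformlyOn_residueFactor ha _) hE
  simp only [hl, logDeriv_apply] at h
  rw [← bernoulliResidue_eq_tprod, div_eq_iff hE] at h
  rw [h, mul_comm]
  rfl

/-! ### Taylor coefficients of `E(A', z)`: Newton's identities and Cauchy estimates. -/

/-- The Taylor coefficients at `0`. -/
noncomputable def taylorCoeff (F : ℂ → ℂ) (s : ℕ) : ℂ := (s.factorial : ℂ)⁻¹ * iteratedDeriv s F 0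

theorem hasSum_taylorCoeff {F : ℂ → ℂ} {R : ℝ} (hF : DifferentiableOn ℂ F (Metric.ball 0 R))
    {z : ℂ} (hz : ‖z‖ < R) : HasSum (fun s => taylorCoeff F s * z ^ s) (F z) := by
  refine (Complex.hasSum_taylorSeries_on_ball hF (z := z) (by simpa using hz)).congr_fun
    fun s => ?_
  simp only [taylorCoeff, smul_eq_mul, sub_zero]
  ring

theorem norm_taylorCoeff_le {F : ℂ → ℂ} {R M : ℝ} (hR : 0 < R)
    (hF : DiffContOnCl ℂ F (Metric.ball 0 R)) (hM : ∀ z : ℂ, ‖z‖ = R → ‖F z‖ ≤ M) (s : ℕ) :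
    ‖taylorCoeff F s‖ ≤ M / R ^ s := by
  have h := Complex.norm_iteratedDeriv_le_of_forall_mem_sphere_norm_le s hR hF
    (C := M) fun z hz => hM z (by simpa using hz)
  have hs : (0 : ℝ) < s.factorial := by positivity
  rw [taylorCoeff, norm_mul, norm_inv, Complex.norm_natCast]
  calc _ ≤ (s.factorial : ℝ)⁻¹ * (s.factorial * M / R ^ s) := by gcongr
    _ = M / R ^ s := by field_simp

theorem taylorCoeff_deriv (F : ℂ → ℂ) (s : ℕ) :
    taylorCoeff (deriv F) s = (s + 1) * taylorCoeff F (s + 1) := by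
  have h : (s.factorial : ℂ) ≠ 0 := by exact_mod_cast s.factorial_ne_zero
  have h' : (s : ℂ) + 1 ≠ 0 := by exact_mod_cast s.succ_ne_zero
  rw [taylorCoeff, taylorCoeff, iteratedDeriv_succ', Nat.factorial_succ]
  push_cast
  field_simp

/-- Rescaling a circle of radius `R` to the unit circle lets `HasGen.unique` and `HasGen.mul`
compare and multiply power series. -/
theorem hasGen_of_hasSum {c : ℕ → ℂ} {F : ℂ → ℂ} {R : ℝ} (hR : 0 ≤ R)
    (h : ∀ z : ℂ, ‖z‖ = R → HasSum (fun s => c s * z ^ s) (F z)) :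
    HasGen (fun s => c s * (R : ℂ) ^ s) (fun w => F (R * w)) := by
  refine ⟨(h R (by simp [hR])).summable.norm, fun w hw => ?_⟩
  refine (h (R * w) (by simp [hw, hR])).congr_fun fun s => ?_
  rw [mul_pow, mul_assoc]

/-- Newton's recursion is the comparison of coefficients in `E' = E · (E' / E)`. -/
theorem succ_mul_taylorCoeff_bernoulliResidue (ha : Summable fun i => a i ^ 2) (k : ℕ) :
    (k + 1) * taylorCoeff (bernoulliResidue a) (k + 1) =
      ∑ j ∈ Finset.range (k + 1), taylorCoeff (bernoulliResidue a) j *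
        ((-1) ^ (k - j) * (virtualPowerSum a (k - j + 1) : ℂ)) := by
  set σ := √(∑' i, a i ^ 2) with hσ
  have hσ0 : 0 ≤ σ := Real.sqrt_nonneg _
  -- Any positive radius with `σ R ≤ 1 / 2` would do; the `+ 1` covers `σ = 0`.
  let R : ℝ := 1 / (2 * (σ + 1))
  have hR : 0 < R := by positivity
  have hσR : σ * R ≤ 1 / 2 := by
    simp only [R]
    rw [mul_one_div, div_le_div_iff₀ (by positivity) two_pos]
    linarith
  have hE := differentiable_bernoulliResidue ha
  have hE' : Differentiable ℂ (deriv (bernoulliResidue a)) :=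
    hE.contDiff.differentiable_deriv_two
  have g1 := hasGen_of_hasSum hR.le (F := bernoulliResidue a) fun z hz =>
    hasSum_taylorCoeff (R := R + 1) hE.differentiableOn (by linarith)
  have g2 := hasGen_of_hasSum hR.le (F := residueLogDeriv a) fun z hz =>
    hasSum_residueLogDeriv ha (by rw [hz]; exact hσR)
  have g3 := hasGen_of_hasSum hR.le (F := deriv (bernoulliResidue a)) fun z hz =>
    hasSum_taylorCoeff (R := R + 1) hE'.differentiableOn (by linarith)
  have g4 := g3.congr fun w hw => deriv_bernoulliResidue ha (z := R * w) (by
    rw [norm_mul, hw, mul_one, Complex.norm_real, Real.norm_of_nonneg hR.le]; exact hσR)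
  have h := congrFun (g4.unique (g1.mul g2)) k
  simp only [taylorCoeff_deriv] at h
  have hRk : (R : ℂ) ^ k ≠ 0 := pow_ne_zero _ (by exact_mod_cast hR.ne')
  rw [Finset.Nat.sum_antidiagonal_eq_sum_range_succ_mk] at h
  refine mul_right_cancel₀ hRk (h.trans ?_)
  rw [Finset.sum_mul]
  refine Finset.sum_congr rfl fun j hj => ?_
  have : j + (k - j) = k := by have := Finset.mem_range.1 hj; omega
  have e : (R : ℂ) ^ k = (R : ℂ) ^ j * (R : ℂ) ^ (k - j) := by rw [← pow_add, this]
  rw [e]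
  ring

theorem taylorCoeff_bernoulliResidue (ha : Summable fun i => a i ^ 2) (s : ℕ) :
    taylorCoeff (bernoulliResidue a) s = virtualElem a s := by
  induction s using Nat.strong_induction_on with
  | _ s ih =>
    rcases s with _ | k
    · simp [taylorCoeff, virtualElem, elemOfPowerSums, bernoulliResidue_zero]
    · have hk : (k : ℂ) + 1 ≠ 0 := by exact_mod_cast k.succ_ne_zero
      refine mul_left_cancel₀ hk ?_
      rw [succ_mul_taylorCoeff_bernoulliResidue ha, virtualElem, elemOfPowerSums]
      push_cast
      rw [mul_div_cancel₀ _ hk, Finset.sum_range]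
      refine Finset.sum_congr rfl fun j _ => ?_
      rw [ih j (by omega), virtualElem, show k + 1 - (j : ℕ) = k - j + 1 by omega]
      ring

theorem hasSum_virtualElem (ha : Summable fun i => a i ^ 2) (z : ℂ) :
    HasSum (fun s => (virtualElem a s : ℂ) * z ^ s) (bernoulliResidue a z) := by
  simp only [← taylorCoeff_bernoulliResidue ha]
  exact hasSum_taylorCoeff (R := ‖z‖ + 1) (differentiable_bernoulliResidue ha).differentiableOn
    (by linarith)

/-- Cauchy's estimate on `|z| = √s / τ`, where the growth bound is at most `exp (s / 2) = √e ^ s`.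
Taking `τ > σ` avoids dividing by zero when the family vanishes. -/
theorem abs_virtualElem_le_of_lt (ha : Summable fun i => a i ^ 2) {s : ℕ} (hs : 1 ≤ s) {τ : ℝ}
    (hτ : √(∑' i, a i ^ 2) < τ) : |virtualElem a s| ≤ (√(Real.exp 1) * τ / √(s : ℝ)) ^ s := by
  have hσ0 : 0 ≤ √(∑' i, a i ^ 2) := Real.sqrt_nonneg _
  have hτ0 : 0 < τ := hσ0.trans_lt hτ
  have hs0 : (0 : ℝ) < s := by exact_mod_cast hs
  have hss : 0 < √(s : ℝ) := Real.sqrt_pos.2 hs0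
  have hR : 0 < √(s : ℝ) / τ := by positivity
  have h := norm_taylorCoeff_le hR (M := Real.exp (s / 2))
    (differentiable_bernoulliResidue ha).diffContOnCl (fun z hz => ?_) s
  · rw [taylorCoeff_bernoulliResidue ha, Complex.norm_real, Real.norm_eq_abs] at h
    refine h.trans_eq ?_
    have e : Real.exp ((s : ℝ) / 2) = √(Real.exp 1) ^ s := by
      rw [← Real.exp_half, ← Real.exp_nat_mul, mul_one_div]
    rw [e, ← div_pow]
    congr 1
    field_simp
  · refine (norm_bernoulliResidue_le ha z).trans (Real.exp_le_exp.2 ?_)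
    rw [hz, div_pow, Real.sq_sqrt hs0.le]
    have h1 : ∑' i, a i ^ 2 ≤ τ ^ 2 := by
      rw [← Real.sq_sqrt (tsum_nonneg fun i => sq_nonneg (a i))]
      gcongr
    have h2 : (∑' i, a i ^ 2) * (s / τ ^ 2) ≤ s := by
      rw [mul_div_assoc', div_le_iff₀ (by positivity), mul_comm]
      gcongr
    linarith

theorem abs_virtualElem_le (ha : Summable fun i => a i ^ 2) {s : ℕ} (hs : 1 ≤ s) :
    |virtualElem a s| ≤ (√(Real.exp 1) * √(∑' i, a i ^ 2) / √(s : ℝ)) ^ s := by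
  have hc : Continuous fun τ : ℝ => (√(Real.exp 1) * τ / √(s : ℝ)) ^ s := by fun_prop
  -- Let `τ` decrease to `σ`.
  refine ge_of_tendsto (hc.continuousAt.continuousWithinAt (s := Set.Ioi (√(∑' i, a i ^ 2)))) ?_
  filter_upwards [self_mem_nhdsWithin] with τ hτ using abs_virtualElem_le_of_lt ha hs hτ

/-! ### The holomorphic remainder and the second approximation bound. -/

theorem genBound_of_differentiableOn {F : ℂ → ℂ} {ρ ε : ℝ} (hρ : 1 < ρ)
    (hF : DifferentiableOn ℂ F (Metric.ball 0 ρ)) (hε : ∀ w ∈ Metric.ball (0 : ℂ) ρ, ‖F w‖ ≤ ε) :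
    GenBound F (2 * (ε * (ρ / (ρ - 1)))) := by
  have hε0 : 0 ≤ ε := (norm_nonneg _).trans (hε 0 (by simp; linarith))
  -- With the midpoint, `R / (R - 1) = (1 + ρ) / (ρ - 1) ≤ 2 ρ / (ρ - 1)`; this `2` is later
  -- cancelled by the half in `dTV`.
  let R := (1 + ρ) / 2
  have hR1 : 1 < R := by simp only [R]; linarith
  have hRρ : R < ρ := by simp only [R]; linarith
  have hsub : Metric.closedBall (0 : ℂ) R ⊆ Metric.ball 0 ρ := Metric.closedBall_subset_ball hRρ
  have hc := norm_taylorCoeff_le (zero_lt_one.trans hR1) (hF.diffContOnCl_ball hsub)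
    fun z hz => hε z (by simpa [hz] using hRρ)
  have hR0 : 0 ≤ R⁻¹ := inv_nonneg.2 (by linarith)
  have hgeo := (hasSum_geometric_of_lt_one hR0 (inv_lt_one_of_one_lt₀ hR1)).mul_left ε
  have hc' : ∀ k, ‖taylorCoeff F k‖ ≤ ε * R⁻¹ ^ k := fun k => by
    rw [inv_pow, ← div_eq_mul_inv]
    exact hc k
  have hs := hgeo.summable.of_nonneg_of_le (fun _ => norm_nonneg _) hc'
  refine ⟨_, ⟨hs, fun w hw => hasSum_taylorCoeff hF (by rwa [hw])⟩, ?_⟩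
  refine (hs.tsum_le_tsum hc' hgeo.summable).trans ?_
  rw [hgeo.tsum_eq, mul_left_comm]
  refine mul_le_mul_of_nonneg_left ?_ hε0
  have h1 : 0 < R - 1 := by linarith
  have h2 : 0 < ρ - 1 := by linarith
  have e : (1 - R⁻¹)⁻¹ = R / (R - 1) := by
    field_simp
  rw [e, mul_div_assoc', div_le_div_iff₀ h1 h2]
  simp only [R]
  nlinarith

section Law

variable {Ω : Type*} [MeasurableSpace Ω] {P : Measure Ω} {X : Ω → ℕ}

theorem differentiableOn_integral_pow (hX : Measurable X) {ρ : ℝ}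
    (h : ∀ w ∈ Metric.ball (0 : ℂ) ρ, Integrable (fun x => w ^ X x) P) :
    DifferentiableOn ℂ (fun w : ℂ => ∫ x, w ^ X x ∂P) (Metric.ball 0 ρ) := fun w hw => by
  -- Integrability at the real point `R` provides a dominating series on the disc of radius `R`.
  obtain ⟨R, hwR, hRρ⟩ := exists_between (show ‖w‖ < ρ by simpa using hw)
  have hR : 0 ≤ R := (norm_nonneg w).trans hwR.le
  have hs := (hasSum_integral_pow hX (h R (by
    simpa [abs_of_nonneg hR] using hRρ))).summable.norm
  have hd := Complex.differentiableOn_tsum_of_summable_norm hs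
    (F := fun (k : ℕ) (w : ℂ) => ((P.map X).real {k} : ℂ) * w ^ k)
    (U := Metric.ball 0 R) (fun k => by fun_prop) Metric.isOpen_ball fun k z hz => by
      have hz' : ‖z‖ ≤ R := by simpa using (Metric.mem_ball.1 hz).le
      simp only [norm_mul, norm_pow]
      gcongr
      rwa [Complex.norm_real, Real.norm_of_nonneg hR]
  have hnhds : Metric.ball (0 : ℂ) R ∈ 𝓝 w := Metric.isOpen_ball.mem_nhds (by simpa using hwR)
  refine ((hd.differentiableAt hnhds).congr_of_eventuallyEq ?_).differentiableWithinAt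
  filter_upwards [hnhds] with z hz
  have hz' : z ∈ Metric.ball (0 : ℂ) ρ := Metric.ball_subset_ball hRρ.le hz
  exact (hasSum_integral_pow hX (h z hz')).tsum_eq.symm

theorem dTV_approxScheme_le_of_norm_residue_sub_le [IsFiniteMeasure P] (hX : Measurable X)
    {l ρ ε : ℝ} {a : ℕ → ℝ} (hρ : 1 < ρ) (ha : Summable fun i => a i ^ 2)
    (hint : ∀ w ∈ Metric.ball (0 : ℂ) ρ, Integrable (fun x => w ^ X x) P)
    (hε : ∀ w ∈ Metric.ball (0 : ℂ) ρ,
      ‖residue P X l w - bernoulliResidue a (w - 1)‖ ≤ ε) (r : ℕ)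
    (hl : 4 * √(Real.exp 1) * √(∑' i, a i ^ 2) < √l) :
    dTV P X (approxScheme l (virtualElem a) r) ≤
      (4 * √(Real.exp 1) * √(∑' i, a i ^ 2) / √l) ^ (r + 1) + ε * (ρ / (ρ - 1)) := by
  rw [mul_assoc] at hl ⊢
  set τ := √(Real.exp 1) * √(∑' i, a i ^ 2) with hτ
  have hτ0 : 0 ≤ τ := by positivity
  have hsl : 0 < √l := lt_of_le_of_lt (by positivity) hl
  have hl0 : 0 < l := Real.sqrt_pos.1 hsl
  have hx : 4 * (τ / √l) < 1 := by rwa [mul_div_assoc', div_lt_one hsl]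
  have hx0 : 0 ≤ τ / √l := by positivity
  have hE : ∀ z : ℂ, HasSum (fun s : ℕ => (virtualElem a (s + 1) : ℂ) * z ^ (s + 1))
      (bernoulliResidue a z - 1) := fun z => by
    have h := (hasSum_nat_add_iff' 1).2 (hasSum_virtualElem ha z)
    simpa [virtualElem, elemOfPowerSums] using h
  have h1 := genBound_tail hl0 hτ0 (b := virtualElem a) (r := r)
    (fun s hs => abs_virtualElem_le ha (by omega)) (by linarith) fun w _ =>
    hasSum_tail_of_hasSum_succ (u := fun s => (virtualElem a s : ℂ) * (w - 1) ^ s)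
      (hE (w - 1)) r
  have hdiff : DifferentiableOn ℂ (fun w => residue P X l w - bernoulliResidue a (w - 1))
      (Metric.ball 0 ρ) := by
    have h2 := differentiable_bernoulliResidue ha
    refine DifferentiableOn.sub (DifferentiableOn.mul (differentiableOn_integral_pow hX hint)
      (by fun_prop)) ?_
    exact (h2.comp (differentiable_id.sub_const 1)).differentiableOn
  -- The Poisson factor has norm at most `1`, so no term `ε * l` arises here.
  have h2 := (genBound_exp hl0.le).mul (genBound_of_differentiableOn hρ hdiff hε)
  have h3 : GenBound (fun w => (∫ x, w ^ X x ∂P) - Complex.exp (l * (w - 1)) *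
      (1 + ∑ s ∈ Finset.Icc 1 r, (virtualElem a s : ℂ) * (w - 1) ^ s)) _ :=
    (h1.add h2).congr fun w _ => by
      rw [integral_pow_eq_exp_mul_residue l]
      ring
  refine (dTV_le_of_genBound hX h3).trans ?_
  rw [mul_div_assoc 4 τ]
  have := half_geometric_tail_le hx0 hx r
  linarith

theorem dTV_nonneg (P : Measure Ω) (X : Ω → ℕ) (ν : ℕ → ℝ) : 0 ≤ dTV P X ν :=
  mul_nonneg (by norm_num) (tsum_nonneg fun _ => abs_nonneg _)

end Law

/-! ### Asymptotics and conclusion. -/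

theorem isBigO_of_le_div_sqrt_pow_add {d l ε : ℕ → ℝ} {κ c : ℝ} {r : ℕ} (hd : ∀ n, 0 ≤ d n)
    (hle : ∀ n, κ < √(l n) → d n ≤ (κ / √(l n)) ^ (r + 1) + ε n * (c + l n))
    (hl : Tendsto l atTop atTop) (hε : ε =O[atTop] fun n => l n ^ (-((r : ℝ) + 3) / 2)) :
    d =O[atTop] fun n => l n ^ (-((r : ℝ) + 1) / 2) := by
  have hpos : ∀ᶠ n in atTop, 0 < l n := hl.eventually_gt_atTop 0
  have h1 : (fun n => (κ / √(l n)) ^ (r + 1)) =O[atTop] fun n => l n ^ (-((r : ℝ) + 1) / 2) := by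
    have h : (fun n => κ ^ (r + 1) * l n ^ (-((r : ℝ) + 1) / 2)) =O[atTop]
        fun n => l n ^ (-((r : ℝ) + 1) / 2) := (isBigO_refl _ _).const_mul_left _
    refine h.congr' ?_ EventuallyEq.rfl
    filter_upwards [hpos] with n hn
    rw [div_pow, div_eq_mul_inv (κ ^ (r + 1)), Real.sqrt_eq_rpow, ← Real.rpow_natCast (l n ^ _),
      ← Real.rpow_mul hn.le, ← Real.rpow_neg hn.le]
    congr 2
    push_cast
    ring
  -- The constant is negligible against `l n`, so the remainder term costs one power of `l n`, which
  -- the exponent `-(r + 3) / 2` allows.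
  have h2 : (fun n => c + l n) =O[atTop] l := by
    refine IsBigO.add ?_ (isBigO_refl _ _)
    exact (isLittleO_const_left.2 (Or.inr (tendsto_norm_atTop_atTop.comp hl))).isBigO
  have h3 : (fun n => ε n * (c + l n)) =O[atTop] fun n => l n ^ (-((r : ℝ) + 1) / 2) := by
    refine (hε.mul h2).congr' EventuallyEq.rfl ?_
    filter_upwards [hpos] with n hn
    rw [← Real.rpow_add_one hn.ne']
    congr 1
    ring
  refine IsBigO.trans (IsBigO.of_bound 1 ?_) (h1.add h3)
  filter_upwards [(Real.tendsto_sqrt_atTop.comp hl).eventually_gt_atTop κ] with n hn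
  rw [one_mul, Real.norm_of_nonneg (hd n)]
  exact (hle n hn).trans (Real.le_norm_self _)

end ModPoisson

theorem theoremC :
    ∃ C D : ℝ, 0 < C ∧ C ≤ 570 ∧ D = 4 ∧
      -- the approximation theorem in which the universal constants `C` and `D` are introduced
      (∀ {Ω : Type*} [MeasurableSpace Ω] (P : Measure Ω) [IsProbabilityMeasure P]
        (X : Ω → ℕ), Measurable X →
        ∀ (l τ : ℝ) (b : ℕ → ℝ), 0 < l → 0 < τ → b 1 = 0 →
        (∀ s : ℕ, 2 ≤ s → |b s| ≤ (τ / √(s : ℝ)) ^ s) →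
        (∀ ξ : ℝ, HasSum
          (fun s : ℕ => (b (s + 1) : ℂ) * (Complex.exp (Complex.I * ξ) - 1) ^ (s + 1))
          (ModPoisson.residue P X l (Complex.exp (Complex.I * ξ)) - 1)) →
        ∀ r : ℕ, 1 ≤ r → D * τ / √l < 1 →
          ModPoisson.dTV P X (ModPoisson.approxScheme l b r) ≤ C * (D * τ / √l) ^ (r + 1)) ∧
      -- the same constants for sequences with Bernoulli asymptotics
      (∀ {Ω : ℕ → Type*} [∀ n, MeasurableSpace (Ω n)] (P : ∀ n, Measure (Ω n))
        [∀ n, IsProbabilityMeasure (P n)] (X : ∀ n, Ω n → ℕ), (∀ n, Measurable (X n)) →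
        ∀ (l : ℕ → ℝ) (a : ℕ → ℝ) (ρ : ℝ) (ε : ℕ → ℝ),
        ModPoisson.ConvergesModPoissonBernoulli P X l a ρ ε →
        ∀ r : ℕ,
          (∀ n : ℕ, D * √(Real.exp 1) * √(∑' i, a i ^ 2) < √(l n) →
            ModPoisson.dTV (P n) (X n)
                (ModPoisson.approxScheme (l n) (ModPoisson.virtualElem a) r) ≤
              C * (D * √(Real.exp 1) * √(∑' i, a i ^ 2) / √(l n)) ^ (r + 1)
                + ε n * (ρ / (ρ - 1) + l n)) ∧
          (Tendsto l atTop atTop →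
            ε =O[atTop] (fun n => l n ^ (-((r : ℝ) + 3) / 2)) →
            (fun n => ModPoisson.dTV (P n) (X n)
                (ModPoisson.approxScheme (l n) (ModPoisson.virtualElem a) r))
              =O[atTop] (fun n => l n ^ (-((r : ℝ) + 1) / 2)))) := by

  -- The argument yields `C = 1`.
  refine ⟨1, 4, one_pos, by norm_num, rfl, ?_, ?_⟩
  · intro Ω _ P _ X hX l τ b hl hτ _ hb h r hr hx
    rw [one_mul]
    refine ModPoisson.dTV_approxScheme_le hX hl hτ.le (fun s hs => hb s (by omega))
      (fun w hw => ?_) hx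
    obtain ⟨ξ, rfl⟩ := (Complex.norm_eq_one_iff w).1 hw
    rw [mul_comm (ξ : ℂ)]
    exact h ξ
  · intro Ω _ P _ X hX l a ρ ε h r
    have hρ := h.one_lt_radius
    -- Nonnegativity, read off at `w = 0`, lets the sharper `ε * (ρ / (ρ - 1))` be weakened by
    -- adding `ε * l`.
    have hε : ∀ n, 0 ≤ ε n := fun n =>
      (norm_nonneg _).trans (h.norm_sub_le n 0 (by simp; linarith))
    have key : ∀ n : ℕ, 4 * √(Real.exp 1) * √(∑' i, a i ^ 2) < √(l n) →
        ModPoisson.dTV (P n) (X n)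
            (ModPoisson.approxScheme (l n) (ModPoisson.virtualElem a) r) ≤
          (4 * √(Real.exp 1) * √(∑' i, a i ^ 2) / √(l n)) ^ (r + 1)
            + ε n * (ρ / (ρ - 1) + l n) := fun n hn => by
      refine (ModPoisson.dTV_approxScheme_le_of_norm_residue_sub_le (hX n) hρ h.summable_sq
        (h.integrable_pow n) (h.norm_sub_le n) r hn).trans ?_
      have hl : 0 ≤ l n := (Real.sqrt_pos.1 (lt_of_le_of_lt (by positivity) hn)).le
      have := hε n
      gcongr
      linarith
    refine ⟨fun n hn => by simpa only [one_mul] using key n hn, fun hl hO => ?_⟩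
    exact ModPoisson.isBigO_of_le_div_sqrt_pow_add (fun n => ModPoisson.dTV_nonneg _ _ _)
      key hl hO
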